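/- Let $\mathbf{N}$ be the set of positive integers and let $\Sigma$ be the set of strictly increasing functions $\sigma:\mathbf{N}\to\mathbf{N}$, endowed with the topology inherited from the product space $\mathbf{N}^{\mathbf{N}}$ (where $\mathbf{N}$ is discrete). For a real sequence $x=(x_n)_{n\in\mathbf{N}}$ and $\sigma\in\Sigma$ write $\sigma(x):=(x_{\sigma(n)})_{n\in\mathbf{N}}$. For an infinite real matrix $A=(a_{n,k})_{n,k\in\mathbf{N}}$ and a real sequence $x$, the sequence $Ax$ is well defined if for each $n$ the series $\sum_k a_{n,k}x_k$ converges (that is, its partial sums have a finite limit), and then $Ax:=\left(\sum_k a_{n,k}x_k\right)_{n\in\mathbf{N}}$. The matrix $A$ is regular if for every real sequence $x$ converging to a real number $\ell$, the sequence $Ax$ is well defined and converges to $\ell$. A real sequence $y$ is statistically convergent if there is $\eta\in\mathbf{R}$ such that for every $\varepsilon>0$ $$\lim_{n\to\infty}\frac{|\{k\in\{1,\dots,n\}: |y_k-\eta|>\varepsilon\}|}{n}=0.$$ Then a real sequence $x$ is convergent (to a finite limit) if and only if there exists a regular matrix $A$ such that the set $$\{\sigma\in\Sigma : A\sigma(x)\text{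 is well defined and statistically convergent}\}$$ is not meager in $\Sigma$. -/

import Mathlib

open Filter Topology

/-! Sequences and infinite matrices are indexed by `ℕ = {0, 1, 2, …}`; the index `n` here plays the
role of the positive integer `n + 1`. -/

/-- The space of strictly increasing maps `ℕ → ℕ`, with the topology inherited from the product
`ℕ → ℕ` of discrete spaces. Its elements `σ` index the subsequences `x ∘ σ` of a sequence `x`. -/
abbrev IncreasingMaps : Type := {σ : ℕ → ℕ // StrictMono σ}

/-- `HasTransform A x y` says that `A x` is well defined and equal to `y`: for each row `n` the
series `∑ k, A n k * x k` converges (as the limit of its partial sums, possibly only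
conditionally) and has sum `y n`. -/
def HasTransform (A : Matrix ℕ ℕ ℝ) (x y : ℕ → ℝ) : Prop :=
  ∀ n, Tendsto (fun m => ∑ k ∈ Finset.range m, A n k * x k) atTop (𝓝 (y n))

/-- A matrix is regular if it maps convergent sequences to convergent sequences and preserves the
limits. -/
def IsRegularMatrix (A : Matrix ℕ ℕ ℝ) : Prop :=
  ∀ (x : ℕ → ℝ) (l : ℝ), Tendsto x atTop (𝓝 l) →
    ∃ y : ℕ → ℝ, HasTransform A x y ∧ Tendsto y atTop (𝓝 l)

/-- `S` has asymptotic density zero: the proportion of elements of `S` among the first `n` indices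
tends to `0`. -/
def HasDensityZero (S : Set ℕ) : Prop :=
  Tendsto (fun n : ℕ => ((S ∩ Set.Iio n).ncard : ℝ) / n) atTop (𝓝 0)

/-- The sequence `y` is statistically convergent (to some real number `η`). -/
def StatisticallyConvergent (y : ℕ → ℝ) : Prop :=
  ∃ η : ℝ, ∀ ε : ℝ, 0 < ε → HasDensityZero {n | ε < |y n - η|}

/-! ### Density -/

/-! If `x` converges, the identity matrix works for every `σ`, and the space of `σ` is a nonempty
Baire space. Conversely, let `x` diverge and `A` be regular. Whatever a finite prefix of `σ` is, its
continuation can steer `A σ(x)` on a block `[a, b)` with `2 * a < b`, so generic `σ` does this for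
arbitrarily large `b` (`eventually_residual_staysOnLongBlocks`). Such blocks fill more than half of
`[0, b)`, which density zero forbids. For bounded `x`, steering towards two distinct cluster points
excludes every statistical limit. For unbounded `x`, either a row with infinitely many nonzero
entries generically gives a divergent series, or all rows are finite and `|A σ(x)|` generically
exceeds every bound on long blocks. -/

theorem hasDensityZero_of_finite {S : Set ℕ} (hS : S.Finite) : HasDensityZero S := by
  refine squeeze_zero (fun n => by positivity) (fun n => ?_)
    (tendsto_const_div_atTop_nhds_zero_nat (S.ncard : ℝ))
  have : (S ∩ Set.Iio n).ncard ≤ S.ncard := Set.ncard_le_ncard Set.inter_subset_left hS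
  gcongr

theorem statisticallyConvergent_of_tendsto {y : ℕ → ℝ} {l : ℝ} (h : Tendsto y atTop (𝓝 l)) :
    StatisticallyConvergent y := by
  refine ⟨l, fun ε hε => hasDensityZero_of_finite ?_⟩
  obtain ⟨N, hN⟩ := Metric.tendsto_atTop.1 h ε hε
  refine (Set.finite_Iio N).subset fun n hn => ?_
  by_contra hlt
  have := hN n (not_lt.1 hlt)
  rw [Real.dist_eq] at this
  exact lt_asymm this hn

/-- The sequence `y` stays in `V` on blocks `[a, b)` with `b` arbitrarily large and `2 a < b`. -/
def StaysOnLongBlocks (y : ℕ → ℝ) (V : Set ℝ) : Prop :=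
  ∀ N, ∃ a b, N ≤ b ∧ 2 * a < b ∧ ∀ n ∈ Finset.Ico a b, y n ∈ V

/-- A set of density zero cannot contain blocks `[a, b)` with `b` arbitrarily large and
`2 a < b`. -/
theorem StaysOnLongBlocks.exists_near {y : ℕ → ℝ} {V : Set ℝ} (hV : StaysOnLongBlocks y V)
    {η ε : ℝ} (h : HasDensityZero {n | ε < |y n - η|}) : ∃ v ∈ V, |v - η| ≤ ε := by
  by_contra! hfar
  have hev := h.eventually (gt_mem_nhds (show (0 : ℝ) < 1 / 2 by norm_num))
  obtain ⟨N, hN⟩ := eventually_atTop.1 hev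
  obtain ⟨a, b, hNb, hab, hblock⟩ := hV N
  have hlt := hN b hNb
  have hsub : (Finset.Ico a b : Set ℕ) ⊆ {n | ε < |y n - η|} ∩ Set.Iio b := fun n hn =>
    ⟨hfar _ (hblock n hn), (Finset.mem_Ico.1 hn).2⟩
  have hcard := Set.ncard_le_ncard hsub ((Set.finite_Iio b).inter_of_right _)
  rw [Set.ncard_coe_finset, Nat.card_Ico] at hcard
  have hb : (0 : ℝ) < b := by
    have : 0 < b := by lia
    exact_mod_cast this
  rw [div_lt_iff₀ hb] at hlt
  have h2 : b < 2 * ({n | ε < |y n - η|} ∩ Set.Iio b).ncard := by lia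
  have h3 : (b : ℝ) < 2 * ({n | ε < |y n - η|} ∩ Set.Iio b).ncard := by exact_mod_cast h2
  linarith

/-! ### The space of strictly increasing maps -/

instance : BaireSpace IncreasingMaps := by
  have hcl : IsClosed {σ : ℕ → ℕ | StrictMono σ} := by
    have : {σ : ℕ → ℕ | StrictMono σ} = ⋂ n, {σ : ℕ → ℕ | σ n < σ (n + 1)} := by
      ext σ
      simp only [Set.mem_ofPred_eq, Set.mem_iInter]
      exact ⟨fun h n => h n.lt_succ_self, strictMono_nat_of_lt_succ⟩
    rw [this]
    refine isClosed_iInter fun n => ?_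
    exact isClosed_le ((continuous_of_discreteTopology (f := Nat.succ)).comp (continuous_apply n))
      (continuous_apply (n + 1))
  have := hcl.polishSpace
  exact inferInstanceAs (BaireSpace {σ : ℕ → ℕ | StrictMono σ})

theorem continuous_eval_comp (x : ℕ → ℝ) (k : ℕ) :
    Continuous fun σ : IncreasingMaps => x (σ.1 k) :=
  (continuous_of_discreteTopology (f := x)).comp
    ((continuous_apply k).comp continuous_subtype_val)

theorem dense_of_forall_exists_agree {D : Set IncreasingMaps}
    (h : ∀ (σ : IncreasingMaps) (p : ℕ), ∃ τ ∈ D, ∀ j < p, τ.1 j = σ.1 j) : Dense D := by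
  intro σ
  choose τ hτD hτ using h σ
  refine mem_closure_of_tendsto (f := τ) (b := atTop) ?_ (Eventually.of_forall hτD)
  rw [tendsto_subtype_rng, tendsto_pi_nhds]
  refine fun j => tendsto_const_nhds.congr' ?_
  filter_upwards [eventually_gt_atTop j] with p hp
  exact (hτ p j hp).symm

theorem exists_agree_apply_eq (σ : IncreasingMaps) (p m : ℕ) (hm : σ.1 p ≤ m) :
    ∃ τ : IncreasingMaps, (∀ j < p, τ.1 j = σ.1 j) ∧ τ.1 p = m := by
  refine ⟨⟨fun j => if j < p then σ.1 j else m + (j - p), fun i j hij => ?_⟩, fun j hj => ?_, ?_⟩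
  · have h1 := σ.2 hij
    by_cases hi : i < p
    · have h2 := σ.2 hi
      simp only [hi, if_true]
      split_ifs <;> lia
    · have hj : ¬ j < p := by lia
      simp only [hi, hj, if_false]
      lia
  · simp [hj]
  · simp

theorem exists_agree_tendsto {x : ℕ → ℝ} {l : ℝ} (hl : MapClusterPt l atTop x)
    (σ : IncreasingMaps) (p : ℕ) :
    ∃ τ : IncreasingMaps, (∀ j < p, τ.1 j = σ.1 j) ∧
      Tendsto (fun n => x (τ.1 n)) atTop (𝓝 l) := by
  obtain ⟨ψ, hψ, hlim⟩ := hl.tendsto_subseq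
  -- As `ψ m ≥ m`, the shift by `σ.1 p` puts the tail above the prefix.
  refine ⟨⟨fun j => if j < p then σ.1 j else ψ (σ.1 p + j), fun i j hij => ?_⟩, fun j hj => ?_, ?_⟩
  · have h1 := σ.2 hij
    have h2 := hψ.le_apply (x := σ.1 p + j)
    have h3 := hψ (Nat.add_lt_add_left hij (σ.1 p))
    by_cases hi : i < p
    · have h4 := σ.2 hi
      simp only [hi, if_true]
      split_ifs <;> lia
    · have hj : ¬ j < p := by lia
      simpa only [hi, hj, if_false] using h3
  · simp [hj]
  · have hadd : Tendsto (fun j => σ.1 p + j) atTop atTop := tendsto_atTop_mono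
      (fun j => Nat.le_add_left j _) tendsto_id
    refine (hlim.comp hadd).congr' ?_
    filter_upwards [eventually_ge_atTop p] with j hj
    simp [hj.not_gt]

/-- The start `a` is fixed before `b`, so `b` can be taken beyond both `N` and `2 * a`; finiteness
of the block gives openness. -/
theorem eventually_residual_staysOnLongBlocks {Y : ℕ → IncreasingMaps → ℝ}
    (hY : ∀ n, Continuous (Y n)) {V : Set ℝ} (hV : IsOpen V)
    (h : ∀ (σ : IncreasingMaps) (p : ℕ), ∃ a, ∀ b, ∃ τ : IncreasingMaps,
      (∀ j < p, τ.1 j = σ.1 j) ∧ ∀ n ∈ Finset.Ico a b, Y n τ ∈ V) :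
    ∀ᶠ σ in residual IncreasingMaps, StaysOnLongBlocks (fun n => Y n σ) V := by
  refine eventually_countable_forall.2 fun N => residual_of_dense_open ?_ ?_
  · simp only [Set.ofPred_exists, Set.ofPred_and, Set.ofPred_forall]
    refine isOpen_iUnion fun a => isOpen_iUnion fun b =>
      isOpen_const.inter (isOpen_const.inter ?_)
    exact isOpen_biInter_finset fun n _ => hV.preimage (hY n)
  · refine dense_of_forall_exists_agree fun σ p => ?_
    obtain ⟨a, ha⟩ := h σ p
    obtain ⟨τ, hτ, hb⟩ := ha (N + 2 * a + 1)
    exact ⟨τ, ⟨a, N + 2 * a + 1, by lia, by lia, hb⟩, hτ⟩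

/-! ### Regular matrices -/

theorem HasTransform.eq_tsum {A : Matrix ℕ ℕ ℝ} {x y : ℕ → ℝ} (h : HasTransform A x y) {n : ℕ}
    (hs : Summable fun k => A n k * x k) : y n = ∑' k, A n k * x k :=
  tendsto_nhds_unique (h n) hs.hasSum.tendsto_sum_nat

theorem HasTransform.tendsto_mul_zero {A : Matrix ℕ ℕ ℝ} {x y : ℕ → ℝ} (h : HasTransform A x y)
    (n : ℕ) : Tendsto (fun k => A n k * x k) atTop (𝓝 0) := by
  have := ((h n).comp (tendsto_add_atTop_nat 1)).sub (h n)
  simpa [Finset.sum_range_succ] using this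

/-- If `∑ a k * c k` converges for every null sequence `c`, then `∑ a k` converges absolutely.
Otherwise, by Abel–Dini, `c k = sign (a k) / (|a 0| + ⋯ + |a k|)` would be a counterexample. -/
theorem summable_abs_of_forall_tendsto_zero {a : ℕ → ℝ}
    (h : ∀ c : ℕ → ℝ, Tendsto c atTop (𝓝 0) →
      ∃ s, Tendsto (fun m => ∑ k ∈ Finset.range m, a k * c k) atTop (𝓝 s)) :
    Summable fun k => |a k| := by
  by_contra hns
  set S : ℕ → ℝ := fun m => ∑ k ∈ Finset.range m, |a k| with hSdef
  have hS : Tendsto S atTop atTop :=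
    (not_summable_iff_tendsto_nat_atTop_of_nonneg fun k => abs_nonneg (a k)).1 hns
  have hmono : Monotone S := by
    refine monotone_nat_of_le_succ fun n => ?_
    simp only [hSdef, Finset.sum_range_succ]
    linarith [abs_nonneg (a n)]
  have hinv : Tendsto (fun k => (S (k + 1))⁻¹) atTop (𝓝 0) :=
    (hS.comp (tendsto_add_atTop_nat 1)).inv_tendsto_atTop
  obtain ⟨s, hs⟩ := h (fun k => (SignType.sign (a k) : ℝ) * (S (k + 1))⁻¹) (by
    refine squeeze_zero_norm (fun k => ?_) (tendsto_norm_zero.comp hinv)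
    rw [norm_mul]
    refine mul_le_of_le_one_left (norm_nonneg _) ?_
    rcases lt_trichotomy (a k) 0 with hk | hk | hk <;> simp [hk])
  have hterm : ∀ k, a k * ((SignType.sign (a k) : ℝ) * (S (k + 1))⁻¹) = |a k| * (S (k + 1))⁻¹ :=
    fun k => by rw [← mul_assoc, self_mul_sign]
  simp only [hterm] at hs
  obtain ⟨N, hN⟩ := Metric.cauchySeq_iff'.1 hs.cauchySeq (1 / 2) (by norm_num)
  obtain ⟨m, hm, hmN, hmpos⟩ := ((eventually_ge_atTop N).and
    ((hS.eventually_ge_atTop (2 * S N)).and (hS.eventually_gt_atTop 0))).exists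
  have hlt := hN m hm
  rw [Real.dist_eq, ← Finset.sum_Ico_eq_sub _ hm] at hlt
  -- Since `S` is monotone, every weight in the block is at least `(S m)⁻¹`. Zero terms are split
  -- off because `S (k + 1)` may then vanish.
  have hge : (S m - S N) * (S m)⁻¹ ≤ ∑ k ∈ Finset.Ico N m, |a k| * (S (k + 1))⁻¹ := by
    rw [hSdef, ← Finset.sum_Ico_eq_sub _ hm, Finset.sum_mul]
    refine Finset.sum_le_sum fun k hk => ?_
    rw [Finset.mem_Ico] at hk
    rcases (abs_nonneg (a k)).eq_or_lt with h0 | h0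
    · simp [← h0]
    · refine mul_le_mul_of_nonneg_left (inv_anti₀ ?_ (hmono (by lia))) h0.le
      exact h0.trans_le (Finset.single_le_sum (f := fun i => |a i|) (fun _ _ => abs_nonneg _)
        (Finset.self_mem_range_succ k))
  have hhalf : 1 / 2 ≤ (S m - S N) * (S m)⁻¹ := by
    rw [← div_eq_mul_inv, le_div_iff₀ hmpos]
    linarith
  linarith [le_abs_self (∑ k ∈ Finset.Ico N m, |a k| * (S (k + 1))⁻¹)]

namespace IsRegularMatrix

variable {A : Matrix ℕ ℕ ℝ}

theorem one : IsRegularMatrix (1 : Matrix ℕ ℕ ℝ) := by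
  refine fun x l hx => ⟨x, fun n => tendsto_const_nhds.congr' ?_, hx⟩
  filter_upwards [eventually_gt_atTop n] with m hm
  simp [Matrix.one_apply, hm]

theorem summable_abs (hA : IsRegularMatrix A) (n : ℕ) : Summable fun k => |A n k| :=
  summable_abs_of_forall_tendsto_zero fun c hc =>
    let ⟨y, hy, _⟩ := hA c 0 hc
    ⟨y n, hy n⟩

theorem tendsto_tsum (hA : IsRegularMatrix A) : Tendsto (fun n => ∑' k, A n k) atTop (𝓝 1) := by
  obtain ⟨y, hy, hlim⟩ := hA (fun _ => 1) 1 tendsto_const_nhds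
  refine hlim.congr fun n => ?_
  simpa using hy.eq_tsum (by simpa using (hA.summable_abs n).of_abs)

theorem tendsto_column (hA : IsRegularMatrix A) (k : ℕ) :
    Tendsto (fun n => A n k) atTop (𝓝 0) := by
  obtain ⟨y, hy, hlim⟩ := hA (Pi.single k 1) 0 (by
    refine tendsto_const_nhds.congr' ?_
    filter_upwards [eventually_gt_atTop k] with m hm
    simp [hm.ne'])
  refine hlim.congr fun n => tendsto_nhds_unique (hy n) (tendsto_const_nhds.congr' ?_)
  filter_upwards [eventually_gt_atTop k] with m hm
  simp [Pi.single_apply, hm]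

/-- Row sums tend to `1` while the first `p` columns tend to `0`, so the tails of the rows cannot
vanish. -/
theorem eventually_exists_ne_zero (hA : IsRegularMatrix A) (p : ℕ) :
    ∀ᶠ n in atTop, ∃ k, p ≤ k ∧ A n k ≠ 0 := by
  have hdiff := hA.tendsto_tsum.sub
    (tendsto_finsetSum (Finset.range p) fun k _ => hA.tendsto_column k)
  simp only [Finset.sum_const_zero, sub_zero] at hdiff
  filter_upwards [hdiff.eventually_ne one_ne_zero] with n hn
  by_contra! hzero
  refine hn (sub_eq_zero.2 (tsum_eq_sum fun k hk => hzero k ?_))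
  simpa using hk

end IsRegularMatrix

/-! ### Bounded sequences -/

theorem exists_mapClusterPt_ne {x : ℕ → ℝ} {B : ℝ} (hB : ∀ n, |x n| ≤ B)
    (hx : ¬ ∃ l, Tendsto x atTop (𝓝 l)) :
    ∃ l₁ l₂, l₁ ≠ l₂ ∧ MapClusterPt l₁ atTop x ∧ MapClusterPt l₂ atTop x := by
  have hmem : ∀ n, x n ∈ Set.Icc (-B) B := fun n => abs_le.1 (hB n)
  obtain ⟨l, -, hl⟩ := isCompact_Icc.exists_mapClusterPt_of_frequently (f := x) (l := atTop)
    (Eventually.of_forall hmem).frequently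
  by_contra! hall
  exact hx ⟨l, isCompact_Icc.tendsto_nhds_of_unique_mapClusterPt (Eventually.of_forall hmem)
    fun m _ hm => by_contra fun hne => hall l m (Ne.symm hne) hl hm⟩

theorem isMeagre_of_bounded {A : Matrix ℕ ℕ ℝ} (hA : IsRegularMatrix A) {x : ℕ → ℝ} {B : ℝ}
    (hB : ∀ n, |x n| ≤ B) (hx : ¬ ∃ l, Tendsto x atTop (𝓝 l)) :
    IsMeagre {σ : IncreasingMaps |
      ∃ y : ℕ → ℝ, HasTransform A (fun n => x (σ.1 n)) y ∧ StatisticallyConvergent y} := by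
  obtain ⟨l₁, l₂, hne, h₁, h₂⟩ := exists_mapClusterPt_ne hB hx
  have hle : ∀ n k (σ : IncreasingMaps), ‖A n k * x (σ.1 k)‖ ≤ |A n k| * B := fun n k σ => by
    rw [norm_mul]
    exact mul_le_mul_of_nonneg_left (hB _) (abs_nonneg _)
  have hsum : ∀ n (σ : IncreasingMaps), Summable fun k => A n k * x (σ.1 k) := fun n σ =>
    ((hA.summable_abs n).mul_right B).of_norm_bounded fun k => hle n k σ
  set Y : ℕ → IncreasingMaps → ℝ := fun n σ => ∑' k, A n k * x (σ.1 k) with hYdef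
  -- Weierstrass M-test: the bound `|A n k| * B` does not depend on `σ`.
  have hYcont : ∀ n, Continuous (Y n) := fun n =>
    continuous_tsum (fun k => continuous_const.mul (continuous_eval_comp x k))
      ((hA.summable_abs n).mul_right B) (hle n)
  -- The path `l₁`, `v₁`, `η`, `v₂`, `l₂` below has four steps of length at most `ε`, the outer two
  -- strictly shorter.
  set ε := |l₁ - l₂| / 4
  have hε : 0 < ε := div_pos (abs_pos.2 (sub_ne_zero.2 hne)) (by norm_num)
  have key : ∀ l, MapClusterPt l atTop x → ∀ᶠ σ in residual IncreasingMaps,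
      StaysOnLongBlocks (fun n => Y n σ) (Metric.ball l ε) := by
    refine fun l hl => eventually_residual_staysOnLongBlocks hYcont Metric.isOpen_ball fun σ p => ?_
    obtain ⟨τ, hτ, hlim⟩ := exists_agree_tendsto hl σ p
    obtain ⟨y, hy, hylim⟩ := hA _ l hlim
    obtain ⟨a, ha⟩ := Metric.tendsto_atTop.1 hylim ε hε
    refine ⟨a, fun b => ⟨τ, hτ, fun n hn => ?_⟩⟩
    have := ha n (Finset.mem_Ico.1 hn).1
    rwa [hy.eq_tsum (hsum n τ)] at this
  filter_upwards [key l₁ h₁, key l₂ h₂] with σ hσ₁ hσ₂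
  rintro ⟨y, hy, η, hη⟩
  obtain rfl : y = fun n => Y n σ := funext fun n => hy.eq_tsum (hsum n σ)
  obtain ⟨v₁, hv₁, hd₁⟩ := hσ₁.exists_near (hη ε hε)
  obtain ⟨v₂, hv₂, hd₂⟩ := hσ₂.exists_near (hη ε hε)
  rw [Metric.mem_ball, Real.dist_eq] at hv₁ hv₂
  have hfour : |l₁ - l₂| = 4 * ε := by
    simp only [ε]
    ring
  rw [abs_lt] at hv₁ hv₂
  rw [abs_le] at hd₁ hd₂
  have : |l₁ - l₂| < 4 * ε := abs_lt.2 ⟨by linarith, by linarith⟩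
  linarith

/-! ### Unbounded sequences -/

theorem exists_ge_lt_abs {x : ℕ → ℝ} (hx : ¬ ∃ B, ∀ n, |x n| ≤ B) (B : ℝ) (N : ℕ) :
    ∃ m, N ≤ m ∧ B < |x m| := by
  by_contra! h
  refine hx ⟨max B (∑ i ∈ Finset.range N, |x i|), fun n => ?_⟩
  rcases le_or_gt N n with hn | hn
  · exact (h n hn).trans (le_max_left _ _)
  · exact (Finset.single_le_sum (f := fun i => |x i|) (fun i _ => abs_nonneg _)
      (Finset.mem_range.2 hn)).trans (le_max_right _ _)

theorem isMeagre_of_infinite_row {A : Matrix ℕ ℕ ℝ} {n : ℕ}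
    (hn : ∀ N, ∃ k, N ≤ k ∧ A n k ≠ 0) {x : ℕ → ℝ} (hx : ¬ ∃ B, ∀ n, |x n| ≤ B) :
    IsMeagre {σ : IncreasingMaps | ∃ y : ℕ → ℝ, HasTransform A (fun n => x (σ.1 n)) y} := by
  have hgen : ∀ᶠ σ in residual IncreasingMaps, ∀ N, ∃ k, N ≤ k ∧ 1 < |A n k * x (σ.1 k)| := by
    refine eventually_countable_forall.2 fun N => residual_of_dense_open ?_ ?_
    · simp only [Set.ofPred_exists, Set.ofPred_and]
      exact isOpen_iUnion fun k => isOpen_const.inter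
        (isOpen_lt continuous_const (continuous_const.mul (continuous_eval_comp x k)).abs)
    · refine dense_of_forall_exists_agree fun σ p => ?_
      obtain ⟨k, hk, hne⟩ := hn (max N p)
      obtain ⟨m, hm, hlt⟩ := exists_ge_lt_abs hx (1 / |A n k|) (σ.1 k)
      obtain ⟨τ, hτ, hτk⟩ := exists_agree_apply_eq σ k m hm
      refine ⟨τ, ⟨k, (le_max_left _ _).trans hk, ?_⟩, fun j hj => hτ j ?_⟩
      · rw [hτk, abs_mul, mul_comm]
        exact (div_lt_iff₀ (abs_pos.2 hne)).1 hlt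
      · exact hj.trans_le ((le_max_right _ _).trans hk)
  filter_upwards [hgen] with σ hσ
  rintro ⟨y, hy⟩
  obtain ⟨N, hN⟩ := Metric.tendsto_atTop.1 (hy.tendsto_mul_zero n) 1 one_pos
  obtain ⟨k, hk, hlt⟩ := hσ N
  have := hN k hk
  rw [Real.dist_eq, sub_zero] at this
  exact lt_asymm this hlt

/-- If the rows `n ∈ s` of `A` have a nonzero entry in a column `≥ p`, then the entries `n ∈ s`
of the transform can be made large by a choice of the index map at the places `≥ p`. -/
theorem exists_agree_lt_abs_sum {A : Matrix ℕ ℕ ℝ} {x : ℕ → ℝ} (hx : ¬ ∃ B, ∀ n, |x n| ≤ B)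
    (M : ℝ) {p : ℕ} {s : Finset ℕ} (hs : ∀ n ∈ s, ∃ k, p ≤ k ∧ A n k ≠ 0) (σ : IncreasingMaps)
    (K : ℕ) (hK : p ≤ K) :
    ∃ τ : IncreasingMaps, (∀ j < p, τ.1 j = σ.1 j) ∧
      ∀ n ∈ s, (∀ k, K ≤ k → A n k = 0) → M < |∑ k ∈ Finset.range K, A n k * x (τ.1 k)| := by
  induction K, hK using Nat.le_induction with
  | base =>
    refine ⟨σ, fun _ _ => rfl, fun n hn hzero => ?_⟩
    obtain ⟨k, hk, hne⟩ := hs n hn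
    exact absurd (hzero k hk) hne
  | succ K hK ih =>
    obtain ⟨τ, hτ, hlarge⟩ := ih
    -- If `|x m|` exceeds `r n` and `A n K ≠ 0`, the new term outweighs the part already fixed by
    -- more than `|M|`; exceeding the sum of all `r n` serves every row at once. Where `A n K = 0`,
    -- division makes `r n = 0`.
    set r : ℕ → ℝ := fun n =>
      (|M| + |∑ k ∈ Finset.range K, A n k * x (τ.1 k)|) / |A n K|
    have hr : ∀ n, 0 ≤ r n := fun n => by positivity
    obtain ⟨m, hm, hlt⟩ := exists_ge_lt_abs hx (∑ n ∈ s, r n) (τ.1 K)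
    obtain ⟨τ', hτ', hτK⟩ := exists_agree_apply_eq τ K m hm
    refine ⟨τ', fun j hj => (hτ' j (hj.trans_le hK)).trans (hτ j hj), fun n hn hzero => ?_⟩
    have hsame : ∑ k ∈ Finset.range K, A n k * x (τ'.1 k) =
        ∑ k ∈ Finset.range K, A n k * x (τ.1 k) :=
      Finset.sum_congr rfl fun k hk => by rw [hτ' k (Finset.mem_range.1 hk)]
    rw [Finset.sum_range_succ, hsame, hτK]
    by_cases hnK : A n K = 0
    · rw [hnK, zero_mul, add_zero]
      refine hlarge n hn fun k hk => ?_
      rcases hk.eq_or_lt with rfl | hk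
      · exact hnK
      · exact hzero k hk
    · have h1 : r n < |x m| := (Finset.single_le_sum (fun i _ => hr i) hn).trans_lt hlt
      rw [div_lt_iff₀ (abs_pos.2 hnK), mul_comm, ← abs_mul] at h1
      have h2 := abs_sub_abs_le_abs_sub (A n K * x m)
        (-∑ k ∈ Finset.range K, A n k * x (τ.1 k))
      rw [abs_neg, sub_neg_eq_add, add_comm (A n K * x m)] at h2
      linarith [le_abs_self M]

theorem isMeagre_of_unbounded {A : Matrix ℕ ℕ ℝ} (hA : IsRegularMatrix A) {x : ℕ → ℝ}
    (hx : ¬ ∃ B, ∀ n, |x n| ≤ B) :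
    IsMeagre {σ : IncreasingMaps |
      ∃ y : ℕ → ℝ, HasTransform A (fun n => x (σ.1 n)) y ∧ StatisticallyConvergent y} := by
  by_cases hrow : ∃ n, ∀ N, ∃ k, N ≤ k ∧ A n k ≠ 0
  · obtain ⟨n, hn⟩ := hrow
    refine (isMeagre_of_infinite_row hn hx).mono ?_
    rintro σ ⟨y, hy, -⟩
    exact ⟨y, hy⟩
  push Not at hrow
  choose L hL using hrow
  set Y : ℕ → IncreasingMaps → ℝ := fun n σ => ∑ k ∈ Finset.range (L n), A n k * x (σ.1 k)
  have hYcont : ∀ n, Continuous (Y n) := fun n =>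
    continuous_finsetSum _ fun k _ => continuous_const.mul (continuous_eval_comp x k)
  have hYeq : ∀ n (σ : IncreasingMaps) m, L n ≤ m →
      ∑ k ∈ Finset.range m, A n k * x (σ.1 k) = Y n σ := fun n σ m hm =>
    (Finset.sum_subset (Finset.range_mono hm) fun k _ hk => by
      rw [hL n k (by simpa using hk), zero_mul]).symm
  have key : ∀ᶠ σ in residual IncreasingMaps, ∀ M : ℕ,
      StaysOnLongBlocks (fun n => Y n σ) {v | (M : ℝ) < |v|} := by
    refine eventually_countable_forall.2 fun M => eventually_residual_staysOnLongBlocks hYcont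
      (isOpen_lt continuous_const continuous_abs) fun σ p => ?_
    obtain ⟨a, ha⟩ := eventually_atTop.1 (hA.eventually_exists_ne_zero p)
    refine ⟨a, fun b => ?_⟩
    obtain ⟨τ, hτ, hlarge⟩ := exists_agree_lt_abs_sum hx M (s := Finset.Ico a b)
      -- This column lies beyond the support of every row of the block.
      (fun n hn => ha n (Finset.mem_Ico.1 hn).1) σ (p + ∑ n ∈ Finset.Ico a b, L n)
      (Nat.le_add_right _ _)
    refine ⟨τ, hτ, fun n hn => ?_⟩
    have hLn : L n ≤ p + ∑ n ∈ Finset.Ico a b, L n :=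
      (Finset.single_le_sum (fun _ _ => Nat.zero_le _) hn).trans (Nat.le_add_left _ _)
    have := hlarge n hn fun k hk => hL n k (hLn.trans hk)
    rwa [hYeq n τ _ hLn] at this
  filter_upwards [key] with σ hσ
  rintro ⟨y, hy, η, hη⟩
  obtain rfl : y = fun n => Y n σ := funext fun n =>
    tendsto_nhds_unique (hy n) (tendsto_const_nhds.congr' (by
      filter_upwards [eventually_ge_atTop (L n)] with m hm
      exact (hYeq n σ m hm).symm))
  obtain ⟨M, hM⟩ := exists_nat_gt (|η| + 1)
  obtain ⟨v, hv, hd⟩ := (hσ M).exists_near (hη 1 one_pos)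
  have hvM : (M : ℝ) < |v| := hv
  linarith [abs_sub_abs_le_abs_sub v η]

theorem corollary2p3 (x : ℕ → ℝ) :
    (∃ l : ℝ, Tendsto x atTop (𝓝 l)) ↔
      ∃ A : Matrix ℕ ℕ ℝ, IsRegularMatrix A ∧
        ¬ IsMeagre {σ : IncreasingMaps |
          ∃ y : ℕ → ℝ, HasTransform A (fun n => x (σ.1 n)) y ∧ StatisticallyConvergent y} := by
  constructor
  · rintro ⟨l, hl⟩
    refine ⟨1, IsRegularMatrix.one, ?_⟩
    have huniv : {σ : IncreasingMaps | ∃ y : ℕ → ℝ,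
        HasTransform 1 (fun n => x (σ.1 n)) y ∧ StatisticallyConvergent y} = Set.univ := by
      refine Set.eq_univ_of_forall fun σ => ?_
      obtain ⟨y, hy, hlim⟩ := IsRegularMatrix.one _ l (hl.comp σ.2.tendsto_atTop)
      exact ⟨y, hy, statisticallyConvergent_of_tendsto hlim⟩
    rw [huniv]
    exact not_isMeagre_of_isOpen isOpen_univ ⟨⟨id, strictMono_id⟩, trivial⟩
  · rintro ⟨A, hA, hA'⟩
    by_contra hx
    by_cases hB : ∃ B, ∀ n, |x n| ≤ B
    · obtain ⟨B, hB⟩ := hB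
      exact hA' (isMeagre_of_bounded hA hB hx)
    · exact hA' (isMeagre_of_unbounded hA hB)
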